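/- Fix an infinite set $\mathbb{D}$ of data values. A finite data word over a finite alphabet $\mathbb{A}$ is a nonempty finite sequence $w=(a_1,d_1)\cdots(a_\ell,d_\ell)$, $\ell\ge 1$, of elements of $\mathbb{A}\times\mathbb{D}$. The formulas of the one-register temporal logic $\mathsf{LTL}^{\downarrow}_{\mathsf{nnf}}(\mathfrak{F},\exists^{\downarrow}_{\ge},\forall^{\downarrow}_{\le})$ over $\mathbb{A}$ are given by $$\varphi ::= a \mid \lnot a \mid {\uparrow} \mid \lnot{\uparrow} \mid {\downarrow}\varphi \mid \mathsf{X}\varphi \mid \bar{\mathsf{X}}\varphi \mid \mathsf{U}(\varphi,\varphi) \mid \bar{\mathsf{U}}(\varphi,\varphi) \mid \exists^{\downarrow}_{\ge}\varphi \mid \forall^{\downarrow}_{\le}\varphi \mid \varphi\land\varphi \mid \varphi\lor\varphi \qquad (a\in\mathbb{A}).$$ For a position $1\le i\le \ell$ and a register value $d\in\mathbb{D}$, the relation $(w,i)\models^d\varphi$ is defined as follows, with $\land$, $\lor$ and the negated atoms $\lnot a$, $\lnot{\uparrow}$ interpreted as usual: - $(w,i)\models^d a$ iff $a_i=a$, and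 $(w,i)\models^d{\uparrow}$ iff $d=d_i$; - $(w,i)\models^d{\downarrow}\varphi$ iff $(w,i)\models^{d_i}\varphi$; - $(w,i)\models^d\mathsf{X}\varphi$ iff $i+1\le \ell$ and $(w,i+1)\models^d\varphi$; - $(w,i)\models^d\mathsf{U}(\varphi,\psi)$ iff there is $j$ with $i\le j\le \ell$ such that $(w,j)\models^d\varphi$ and $(w,k)\models^d\psi$ for all $i\le k<j$; - $\bar{\mathsf{X}}$ and $\bar{\mathsf{U}}$ are the duals of $\mathsf{X}$ and $\mathsf{U}$: $(w,i)\models^d\bar{\mathsf{X}}\varphi$ iff $i=\ell$ or $(w,i+1)\models^d\varphi$; and $(w,i)\models^d\bar{\mathsf{U}}(\varphi,\psi)$ iff for every $j$ with $i\le j\le \ell$, $(w,j)\models^d\varphi$ or $(w,k)\models^d\psi$ for some $i\le k<j$; - $(w,i)\models^d\exists^{\downarrow}_{\ge}\varphi$ iff $(w,i)\models^{d_j}\varphi$ for some $i\le j\le \ell$; - $(w,i)\models^d\forall^{\downarrow}_{\le}\varphi$ iff $(w,i)\models^{d_j}\varphi$ for all $1\le j\le i$. The word $w$ satisfies $\varphi$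 if $(w,1)\models^{d_1}\varphi$. **Theorem.** The satisfiability problem for $\mathsf{LTL}^{\downarrow}_{\mathsf{nnf}}(\mathfrak{F},\exists^{\downarrow}_{\ge},\forall^{\downarrow}_{\le})$ on finite data words is decidable: there is an algorithm which, given a finite alphabet $\mathbb{A}$ (say $\mathbb{A}=\{0,\dots,n-1\}$, given by $n$) and a formula $\varphi$ over $\mathbb{A}$, decides whether some finite data word over $\mathbb{A}$ and $\mathbb{D}$ satisfies $\varphi$. -/

import Mathlib

/-- Formulas of LTL with one register in negation normal form over the alphabet `A`, with the
forward modalities `U`, its dual, `X`, its dual, and the quantifiers `∃≥↓`, `∀≤↓`. -/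
inductive LTLFormula (A : Type*) : Type _
  /-- the current letter is `a` -/
  | letter (a : A)
  /-- the current letter is not `a` -/
  | notLetter (a : A)
  /-- the current datum equals the register -/
  | test
  /-- the current datum differs from the register -/
  | notTest
  /-- store the current datum in the register -/
  | freeze (φ : LTLFormula A)
  /-- (strong) next -/
  | next (φ : LTLFormula A)
  /-- dual of next -/
  | dualNext (φ : LTLFormula A)
  /-- `U(φ, ψ)`: eventually `φ`, and `ψ` at all positions before -/
  | untl (φ ψ : LTLFormula A)
  /-- dual of until -/
  | dualUntil (φ ψ : LTLFormula A)
  /-- `∃≥↓ φ`: for some datum of the present or the future, put in the register, `φ` holds here -/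
  | existsFuture (φ : LTLFormula A)
  /-- `∀≤↓ φ`: for every datum of the past or the present, put in the register, `φ` holds here -/
  | forallPast (φ : LTLFormula A)
  | and (φ ψ : LTLFormula A)
  | or (φ ψ : LTLFormula A)

/-- A finite data word over the alphabet `A` and the data domain `D`: a nonempty finite word over
`A × D`, with positions `0, …, length - 1`. -/
structure DataWord (A D : Type*) where
  length : ℕ
  length_pos : 0 < length
  letter : Fin length → A
  datum : Fin length → D

namespace DataWord

variable {A D : Type*}

/-- The first position. -/
def first (w : DataWord A D) : Fin w.length := ⟨0, w.length_pos⟩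

/-- `w.Sat i d φ`: the formula `φ` holds in `w` at position `i` with register value `d`. -/
def Sat (w : DataWord A D) : Fin w.length → D → LTLFormula A → Prop
  | i, _, .letter a => w.letter i = a
  | i, _, .notLetter a => w.letter i ≠ a
  | i, d, .test => d = w.datum i
  | i, d, .notTest => d ≠ w.datum i
  | i, _, .freeze φ => w.Sat i (w.datum i) φ
  | i, d, .next φ => ∃ h : i.val + 1 < w.length, w.Sat ⟨i.val + 1, h⟩ d φ
  | i, d, .dualNext φ => ∀ h : i.val + 1 < w.length, w.Sat ⟨i.val + 1, h⟩ d φ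
  | i, d, .untl φ ψ => ∃ j, i ≤ j ∧ w.Sat j d φ ∧ ∀ k, i ≤ k → k < j → w.Sat k d ψ
  | i, d, .dualUntil φ ψ => ∀ j, i ≤ j → w.Sat j d φ ∨ ∃ k, i ≤ k ∧ k < j ∧ w.Sat k d ψ
  | i, _, .existsFuture φ => ∃ j, i ≤ j ∧ w.Sat i (w.datum j) φ
  | i, _, .forallPast φ => ∀ j, j ≤ i → w.Sat i (w.datum j) φ
  | i, d, .and φ ψ => w.Sat i d φ ∧ w.Sat i d ψ
  | i, d, .or φ ψ => w.Sat i d φ ∨ w.Sat i d ψ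

/-- `w ⊨ φ`: evaluation starts at the first position, with the first datum in the register. -/
def Models (w : DataWord A D) (φ : LTLFormula A) : Prop :=
  w.Sat w.first (w.datum w.first) φ

end DataWord

namespace LTLFormula

/-- `φ` holds in some finite data word over the alphabet `A` and the data domain `D`. -/
def Satisfiable {A : Type*} (D : Type*) (φ : LTLFormula A) : Prop :=
  ∃ w : DataWord A D, w.Models φ

/-! A Gödel numbering of the formulas over the `n`-letter alphabet `Fin n`: the atoms
are numbered first, then the compound formulas, by their outermost connective (modulo 9) and the
numbers of their immediate subformulas. It is a bijection with `ℕ`. -/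

/-- The Gödel number of a formula. -/
def toCode {n : ℕ} : LTLFormula (Fin n) → ℕ
  | .test => 0
  | .notTest => 1
  | .letter a => a.val + 2
  | .notLetter a => a.val + n + 2
  | .freeze φ => 9 * toCode φ + (2 * n + 2)
  | .next φ => 9 * toCode φ + 1 + (2 * n + 2)
  | .dualNext φ => 9 * toCode φ + 2 + (2 * n + 2)
  | .existsFuture φ => 9 * toCode φ + 3 + (2 * n + 2)
  | .forallPast φ => 9 * toCode φ + 4 + (2 * n + 2)
  | .untl φ ψ => 9 * Nat.pair (toCode φ) (toCode ψ) + 5 + (2 * n + 2)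
  | .dualUntil φ ψ => 9 * Nat.pair (toCode φ) (toCode ψ) + 6 + (2 * n + 2)
  | .and φ ψ => 9 * Nat.pair (toCode φ) (toCode ψ) + 7 + (2 * n + 2)
  | .or φ ψ => 9 * Nat.pair (toCode φ) (toCode ψ) + 8 + (2 * n + 2)

/-- The formula with a given Gödel number. -/
def ofCode (n : ℕ) (c : ℕ) : LTLFormula (Fin n) :=
  if c = 0 then .test
  else if c = 1 then .notTest
  else if h₁ : c - 2 < n then .letter ⟨c - 2, h₁⟩
  else if h₂ : c - 2 - n < n then .notLetter ⟨c - 2 - n, h₂⟩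
  else
    let q := (c - (2 * n + 2)) / 9
    match (c - (2 * n + 2)) % 9 with
    | 0 => .freeze (ofCode n q)
    | 1 => .next (ofCode n q)
    | 2 => .dualNext (ofCode n q)
    | 3 => .existsFuture (ofCode n q)
    | 4 => .forallPast (ofCode n q)
    | 5 => .untl (ofCode n q.unpair.1) (ofCode n q.unpair.2)
    | 6 => .dualUntil (ofCode n q.unpair.1) (ofCode n q.unpair.2)
    | 7 => .and (ofCode n q.unpair.1) (ofCode n q.unpair.2)
    | _ => .or (ofCode n q.unpair.1) (ofCode n q.unpair.2)
termination_by c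
decreasing_by
  all_goals
    have h1 := Nat.unpair_left_le ((c - (2 * n + 2)) / 9)
    have h2 := Nat.unpair_right_le ((c - (2 * n + 2)) / 9)
    omega

theorem ofCode_toCode {n : ℕ} (φ : LTLFormula (Fin n)) : ofCode n (toCode φ) = φ := by
  have key : ∀ m r : ℕ, r < 9 → (9 * m + r) / 9 = m ∧ (9 * m + r) % 9 = r := by
    intro m r hr; omega
  have h9 : ∀ m : ℕ, 9 * m / 9 = m ∧ 9 * m % 9 = 0 := by intro m; omega
  induction φ with
  | test => rw [toCode, ofCode]; simp
  | notTest => rw [toCode, ofCode]; simp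
  | letter a => rw [toCode, ofCode]; simp
  | notLetter a => rw [toCode, ofCode]; simp
  | freeze φ ih =>
    rw [toCode, ofCode, if_neg (by omega), if_neg (by omega), dif_neg (by omega),
      dif_neg (by omega)]
    simp [h9, ih]
  | next φ ih | dualNext φ ih | existsFuture φ ih | forallPast φ ih =>
    rw [toCode, ofCode, if_neg (by omega), if_neg (by omega), dif_neg (by omega),
      dif_neg (by omega)]
    simp [key, ih]
  | untl φ ψ ih₁ ih₂ | dualUntil φ ψ ih₁ ih₂ | and φ ψ ih₁ ih₂ | or φ ψ ih₁ ih₂ =>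
    rw [toCode, ofCode, if_neg (by omega), if_neg (by omega), dif_neg (by omega),
      dif_neg (by omega)]
    simp [key, ih₁, ih₂]

theorem toCode_ofCode (n c : ℕ) : toCode (ofCode n c) = c := by
  induction c using Nat.strong_induction_on with
  | _ c ih =>
    rw [ofCode]
    split_ifs with h0 h1 h2 h3
    · simp [toCode, h0]
    · simp [toCode, h1]
    · simp only [toCode]; omega
    · simp only [toCode]; omega
    · have hq : (c - (2 * n + 2)) / 9 < c := by omega
      have e := ih _ hq
      have e1 := ih _ ((Nat.unpair_left_le ((c - (2 * n + 2)) / 9)).trans_lt hq)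
      have e2 := ih _ ((Nat.unpair_right_le ((c - (2 * n + 2)) / 9)).trans_lt hq)
      have hlt : (c - (2 * n + 2)) % 9 < 9 := Nat.mod_lt _ (by norm_num)
      dsimp only
      generalize hr : (c - (2 * n + 2)) % 9 = r at hlt
      interval_cases r <;> simp only [toCode, e, e1, e2, Nat.pair_unpair] <;> omega

/-- Formulas over `Fin n` are numbered bijectively by `toCode`. -/
instance instDenumerable (n : ℕ) : Denumerable (LTLFormula (Fin n)) :=
  Denumerable.mk' ⟨toCode, ofCode n, ofCode_toCode, toCode_ofCode n⟩

/-- Instances `⟨n, φ⟩` of the satisfiability problem, an alphabet size and a formula over the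
alphabet `Fin n`, are coded by the number `Nat.pair n (toCode φ)`. -/
instance instPrimcodableSigma : Primcodable (Σ n : ℕ, LTLFormula (Fin n)) :=
  Primcodable.ofDenumerable _

theorem encode_sigma (n : ℕ) (φ : LTLFormula (Fin n)) :
    Encodable.encode (⟨n, φ⟩ : Σ n : ℕ, LTLFormula (Fin n)) = Nat.pair n (toCode φ) := rfl

end LTLFormula

/-! By Post's theorem it suffices to enumerate both the satisfiable and the unsatisfiable instances.
The data may be taken in `ℕ`, because a word has finitely many data and satisfaction is invariant
under injective renaming (`satisfiable_iff_nat`).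

A model is unfolded into a run: each position carries a finite set of obligations, that is, pairs of
a register value and a formula, and consecutive sets are linked by the local conditions `LayerStep`.
Satisfiability amounts to the existence of a run that meets one initial obligation
(`satisfiable_iff_hasRun`). A run is a finite object with a primitive recursive check, so
satisfiability is recursively enumerable.

For the complement, sets of obligations are ordered by inclusion up to injective renaming of data
(`Embeds`); with boundedly many formulas this is a well-quasi-order by Higman's lemma. The form of
the logic enters in `LayerStep.restrict`: a step can be cut down to the data of a given set, the
current datum and one witness for each `∃≥↓` formula. All other conditions, `∀≤↓` included, survive
the loss of data. So if a set has no run, neither has any set above it, and the sets without a run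
are generated by finitely many of them. Such a finite family certifies itself: none of its members
can be met at a last position, and each step on boundedly many data leads above a member again. This
is a `Refutation`; it can be checked by bounded search, it excludes runs (`Refutation.not_hasRun`),
and it exists whenever there is no run (`exists_refutation`). -/

/-! ### Primitive recursive predicates -/

section Primrec

variable {α : Type*} [Primcodable α]

theorem Primrec.add_fun {f g : α → ℕ} (hf : Primrec f) (hg : Primrec g) :
    Primrec fun v => f v + g v := Primrec.nat_add.comp hf hg

theorem Primrec.mul_fun {f g : α → ℕ} (hf : Primrec f) (hg : Primrec g) :
    Primrec fun v => f v * g v := Primrec.nat_mul.comp hf hg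

theorem Primrec.pair_fun {f g : α → ℕ} (hf : Primrec f) (hg : Primrec g) :
    Primrec fun v => Nat.pair (f v) (g v) := Primrec₂.natPair.comp hf hg

theorem Primrec.div_fun {f g : α → ℕ} (hf : Primrec f) (hg : Primrec g) :
    Primrec fun v => f v / g v := Primrec.nat_div.comp hf hg

theorem Primrec.mod_fun {f g : α → ℕ} (hf : Primrec f) (hg : Primrec g) :
    Primrec fun v => f v % g v := Primrec.nat_mod.comp hf hg

theorem Primrec.fst_fun {β γ : Type*} [Primcodable β] [Primcodable γ] {f : α → β × γ}
    (hf : Primrec f) : Primrec fun v => (f v).1 := Primrec.fst.comp hf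

theorem Primrec.snd_fun {β γ : Type*} [Primcodable β] [Primcodable γ] {f : α → β × γ}
    (hf : Primrec f) : Primrec fun v => (f v).2 := Primrec.snd.comp hf

theorem Primrec.unpair_fun {f : α → ℕ} (hf : Primrec f) : Primrec fun v => (f v).unpair :=
  Primrec.unpair.comp hf

theorem Primrec.pow_fun {f g : α → ℕ} (hf : Primrec f) (hg : Primrec g) :
    Primrec fun v => f v ^ g v :=
  (Primrec.nat_rec' (h := fun v p => p.2 * f v) hg (Primrec.const 1)
    (Primrec.mul_fun (Primrec.snd.comp Primrec.snd) (hf.comp Primrec.fst))).of_eq fun v => by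
      induction g v with
      | zero => rfl
      | succ k ih => simpa [pow_succ] using congrArg (· * f v) ih

theorem PrimrecPred.testBit {f g : α → ℕ} (hf : Primrec f) (hg : Primrec g) :
    PrimrecPred fun v => (f v).testBit (g v) = true :=
  (Primrec.eq.comp (Primrec.nat_mod.comp (Primrec.nat_div.comp hf
    (Primrec.pow_fun (Primrec.const 2) hg)) (Primrec.const 2)) (Primrec.const 1)).of_eq
    fun v => by simp [Nat.testBit_eq_decide_div_mod_eq]

theorem PrimrecPred.const (p : Prop) : PrimrecPred fun _ : α => p := by
  classical exact ⟨fun _ => inferInstance, Primrec.const _⟩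

theorem PrimrecPred.imp {p q : α → Prop} (hp : PrimrecPred p) (hq : PrimrecPred q) :
    PrimrecPred fun v => p v → q v :=
  (hp.not.or hq).of_eq fun _ => by tauto

theorem PrimrecPred.ball {p : α → ℕ → Prop} {f : α → ℕ} (hf : Primrec f)
    (hp : PrimrecPred fun y : α × ℕ => p y.1 y.2) : PrimrecPred fun v => ∀ i < f v, p v i :=
  ((PrimrecRel.forall_mem_list (R := fun i v => p v i)
    (hp.comp (Primrec.pair Primrec.snd Primrec.fst))).comp
    (Primrec.list_range.comp hf) Primrec.id).of_eq fun v => by simp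

theorem PrimrecPred.bex {p : α → ℕ → Prop} {f : α → ℕ} (hf : Primrec f)
    (hp : PrimrecPred fun y : α × ℕ => p y.1 y.2) : PrimrecPred fun v => ∃ i < f v, p v i :=
  ((PrimrecRel.exists_mem_list (R := fun i v => p v i)
    (hp.comp (Primrec.pair Primrec.snd Primrec.fst))).comp
    (Primrec.list_range.comp hf) Primrec.id).of_eq fun v => by simp

/-- The projection of a primitive recursive relation is recursively enumerable. -/
theorem PrimrecPred.rePred_exists {β : Type*} [Primcodable β] {p : α → β → Prop}
    (hp : PrimrecPred fun y : α × β => p y.1 y.2) : REPred fun v => ∃ y, p v y := by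
  obtain ⟨hdec, hp⟩ := hp
  have : ∀ v y, Decidable (p v y) := fun v y => hdec (v, y)
  replace hp : Primrec fun y : α × β => decide (p y.1 y.2) := hp.of_eq fun _ => by congr
  -- Numbers that decode to nothing count as failures, so the tested function is total and the
  -- unbounded search passes over them.
  have h : Computable₂ fun (v : α) (k : ℕ) =>
      ((Encodable.decode (α := β) k).map fun y => decide (p v y)).getD false :=
    (Primrec.option_getD.comp (Primrec.option_map (Primrec.decode.comp Primrec.snd)
      (hp.comp (Primrec.pair (Primrec.fst.comp Primrec.fst) Primrec.snd)).to₂)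
      (Primrec.const false)).to_comp
  refine (Partrec.rfind h.partrec₂).dom_re.of_eq fun v => ?_
  rw [Nat.rfind_dom]
  constructor
  · rintro ⟨k, hk, -⟩
    rcases hy : Encodable.decode (α := β) k with _ | y
    · simp [hy] at hk
    · exact ⟨y, by simpa [hy] using hk⟩
  · rintro ⟨y, hy⟩
    exact ⟨Encodable.encode y, by simpa using hy, by simp⟩

end Primrec

/-! ### Finite sets of pairs, coded by the binary digits of a number -/

namespace Nat

/-- The set of pairs whose numbers are the positions of the binary digits `1` of `t`. -/
def Bits (t e q : ℕ) : Prop := t.testBit (Nat.pair e q) = true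

theorem lt_of_testBit_eq_true {t i : ℕ} (h : t.testBit i = true) : i < t :=
  Nat.lt_two_pow_self.trans_le (Nat.ge_two_pow_of_testBit h)

theorem Bits.left_lt {t e q : ℕ} (h : t.Bits e q) : e < t :=
  (Nat.left_le_pair e q).trans_lt (lt_of_testBit_eq_true h)

theorem Bits.right_lt {t e q : ℕ} (h : t.Bits e q) : q < t :=
  (Nat.right_le_pair e q).trans_lt (lt_of_testBit_eq_true h)

theorem bits_two_pow {e q e' q' : ℕ} : (2 ^ Nat.pair e q).Bits e' q' ↔ e' = e ∧ q' = q := by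
  rw [Bits, Nat.testBit_two_pow, decide_eq_true_iff, Nat.pair_eq_pair]
  tauto

theorem primrecPred_bits {α : Type*} [Primcodable α] {t e q : α → ℕ} (ht : Primrec t)
    (he : Primrec e) (hq : Primrec q) : PrimrecPred fun v => (t v).Bits (e v) (q v) :=
  PrimrecPred.testBit ht (Primrec.pair_fun he hq)

theorem exists_testBit_iff (L : ℕ) (P : ℕ → Prop) (hP : ∀ i, P i → i < L) :
    ∃ t < 2 ^ L, ∀ i, t.testBit i = true ↔ P i := by
  classical
  refine ⟨Nat.ofBits fun i : Fin L => decide (P i), Nat.ofBits_lt_two_pow _, fun i => ?_⟩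
  rcases lt_or_ge i L with h | h
  · simp [Nat.testBit_ofBits_lt _ _ h]
  · simpa [Nat.testBit_ofBits_ge _ _ h] using fun hi => absurd (hP i hi) (by omega)

theorem exists_bits_iff (N : ℕ) (P : ℕ → ℕ → Prop) (hP : ∀ e q, P e q → e < N ∧ q < N) :
    ∃ t < 2 ^ (N * N), ∀ e q, t.Bits e q ↔ P e q := by
  obtain ⟨t, ht, h⟩ := exists_testBit_iff (N * N) (fun i => P i.unpair.1 i.unpair.2) fun i hi => by
    obtain ⟨h1, h2⟩ := hP _ _ hi
    calc i = Nat.pair i.unpair.1 i.unpair.2 := (Nat.pair_unpair i).symm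
      _ < (max i.unpair.1 i.unpair.2 + 1) ^ 2 := Nat.pair_lt_max_add_one_sq _ _
      _ ≤ N * N := by rw [sq]; exact Nat.mul_le_mul (max_lt h1 h2) (max_lt h1 h2)
  exact ⟨t, ht, fun e q => by simp [Bits, h]⟩

end Nat

/-! ### Layers -/

namespace LTLFormula

/-- The code of a compound formula with connective `r` and subformula number `x`. -/
def compound (n r x : ℕ) : ℕ := 9 * x + r + (2 * n + 2)

/-- `T` is a set of pairs of a datum and an obligation. The obligation `0` says that the datum has
been seen, `1` that it is still to come, `c + 2` that the formula with number `c` holds with the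
datum in the register. `LayerStep n last a d T C` says that the obligations `T` are met at a
position that carries the letter `a` and the datum `d`, provided that `C` is met at the next
position, or the position is the last one. -/
structure LayerStep (n : ℕ) (last : Prop) (a d : ℕ) (T C : ℕ → ℕ → Prop) : Prop where
  seen_self : T d 0
  seen : ∀ e, T e 0 → last ∨ C e 0
  future : ∀ e, T e 1 → e = d ∨ (¬last ∧ C e 1)
  test : ∀ e, T e 2 → e = d
  notTest : ∀ e, T e 3 → e ≠ d
  letter : ∀ e x, x < n → T e (x + 4) → x = a
  notLetter : ∀ e x, x < n → T e (x + n + 4) → x ≠ a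
  freeze : ∀ e x, T e (compound n 0 x + 2) → T d (x + 2)
  next : ∀ e x, T e (compound n 1 x + 2) → ¬last ∧ C e (x + 2)
  dualNext : ∀ e x, T e (compound n 2 x + 2) → last ∨ C e (x + 2)
  existsFuture : ∀ e x, T e (compound n 3 x + 2) → ∃ e', T e' (x + 2) ∧ T e' 1
  forallPast : ∀ e x, T e (compound n 4 x + 2) → ∀ e', T e' 0 → T e' (x + 2)
  untl : ∀ e x y, T e (compound n 5 (Nat.pair x y) + 2) →
    T e (x + 2) ∨ (T e (y + 2) ∧ ¬last ∧ C e (compound n 5 (Nat.pair x y) + 2))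
  dualUntil : ∀ e x y, T e (compound n 6 (Nat.pair x y) + 2) →
    T e (x + 2) ∧ (T e (y + 2) ∨ last ∨ C e (compound n 6 (Nat.pair x y) + 2))
  and : ∀ e x y, T e (compound n 7 (Nat.pair x y) + 2) → T e (x + 2) ∧ T e (y + 2)
  or : ∀ e x y, T e (compound n 8 (Nat.pair x y) + 2) → T e (x + 2) ∨ T e (y + 2)

theorem le_compound (n r x : ℕ) : x ≤ compound n r x := by unfold compound; omega

/-- Data and obligations in the set coded by `t` are below `t`, and a subformula number does not
exceed that of the compound formula. Bounding all quantifiers by `t` therefore loses nothing and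
makes the condition primitive recursive. -/
theorem layerStep_bits_iff {n : ℕ} {last : Prop} {a d t s : ℕ} :
    LayerStep n last a d t.Bits s.Bits ↔ t.Bits d 0 ∧ ∀ e < t, ∀ x < t,
      (t.Bits e 0 → last ∨ s.Bits e 0) ∧
      (t.Bits e 1 → e = d ∨ (¬last ∧ s.Bits e 1)) ∧
      (t.Bits e 2 → e = d) ∧
      (t.Bits e 3 → ¬e = d) ∧
      (x < n → t.Bits e (x + 4) → x = a) ∧
      (x < n → t.Bits e (x + n + 4) → ¬x = a) ∧
      (t.Bits e (compound n 0 x + 2) → t.Bits d (x + 2)) ∧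
      (t.Bits e (compound n 1 x + 2) → ¬last ∧ s.Bits e (x + 2)) ∧
      (t.Bits e (compound n 2 x + 2) → last ∨ s.Bits e (x + 2)) ∧
      (t.Bits e (compound n 3 x + 2) → ∃ e' < t, t.Bits e' (x + 2) ∧ t.Bits e' 1) ∧
      (t.Bits e (compound n 4 x + 2) → ∀ e' < t, t.Bits e' 0 → t.Bits e' (x + 2)) ∧
      ∀ y < t,
      (t.Bits e (compound n 5 (Nat.pair x y) + 2) →
        t.Bits e (x + 2) ∨
          (t.Bits e (y + 2) ∧ ¬last ∧ s.Bits e (compound n 5 (Nat.pair x y) + 2))) ∧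
      (t.Bits e (compound n 6 (Nat.pair x y) + 2) →
        t.Bits e (x + 2) ∧
          (t.Bits e (y + 2) ∨ last ∨ s.Bits e (compound n 6 (Nat.pair x y) + 2))) ∧
      (t.Bits e (compound n 7 (Nat.pair x y) + 2) → t.Bits e (x + 2) ∧ t.Bits e (y + 2)) ∧
      (t.Bits e (compound n 8 (Nat.pair x y) + 2) → t.Bits e (x + 2) ∨ t.Bits e (y + 2)) := by
  constructor
  · intro h
    refine ⟨h.seen_self, fun e _ x _ => ⟨h.seen e, h.future e, h.test e, h.notTest e, h.letter e x,
      h.notLetter e x, h.freeze e x, h.next e x, h.dualNext e x, fun hb => ?_,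
      fun hb e' _ => h.forallPast e x hb e', fun y _ => ⟨h.untl e x y, h.dualUntil e x y,
      h.and e x y, h.or e x y⟩⟩⟩
    obtain ⟨e', h1, h2⟩ := h.existsFuture e x hb
    exact ⟨e', h1.left_lt, h1, h2⟩
  · rintro ⟨h0, h⟩
    have hx : ∀ {e r x}, t.Bits e (compound n r x + 2) → x < t := fun {e r x} hb => by
      have := hb.right_lt
      have := le_compound n r x
      omega
    have hl : ∀ {e r x y}, t.Bits e (compound n r (Nat.pair x y) + 2) → x < t := fun hb =>
      (Nat.left_le_pair _ _).trans_lt (hx hb)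
    have hr : ∀ {e r x y}, t.Bits e (compound n r (Nat.pair x y) + 2) → y < t := fun hb =>
      (Nat.right_le_pair _ _).trans_lt (hx hb)
    -- The clauses that do not mention `x` are extracted at the dummy value `x = 0`.
    have hp : 0 < t := (Nat.zero_le _).trans_lt h0.left_lt
    refine ⟨h0, fun e hb => (h e hb.left_lt 0 hp).1 hb, fun e hb => (h e hb.left_lt 0 hp).2.1 hb,
      fun e hb => (h e hb.left_lt 0 hp).2.2.1 hb, fun e hb => (h e hb.left_lt 0 hp).2.2.2.1 hb,
      fun e x hxn hb => (h e hb.left_lt x ?_).2.2.2.2.1 hxn hb,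
      fun e x hxn hb => (h e hb.left_lt x ?_).2.2.2.2.2.1 hxn hb,
      fun e x hb => (h e hb.left_lt x (hx hb)).2.2.2.2.2.2.1 hb,
      fun e x hb => (h e hb.left_lt x (hx hb)).2.2.2.2.2.2.2.1 hb,
      fun e x hb => (h e hb.left_lt x (hx hb)).2.2.2.2.2.2.2.2.1 hb,
      fun e x hb => ?_,
      fun e x hb e' hb' =>
        (h e hb.left_lt x (hx hb)).2.2.2.2.2.2.2.2.2.2.1 hb e' hb'.left_lt hb',
      fun e x y hb =>
        ((h e hb.left_lt x (hl hb)).2.2.2.2.2.2.2.2.2.2.2 y (hr hb)).1 hb,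
      fun e x y hb =>
        ((h e hb.left_lt x (hl hb)).2.2.2.2.2.2.2.2.2.2.2 y (hr hb)).2.1 hb,
      fun e x y hb =>
        ((h e hb.left_lt x (hl hb)).2.2.2.2.2.2.2.2.2.2.2 y (hr hb)).2.2.1 hb,
      fun e x y hb =>
        ((h e hb.left_lt x (hl hb)).2.2.2.2.2.2.2.2.2.2.2 y (hr hb)).2.2.2 hb⟩
    · have := hb.right_lt; omega
    · have := hb.right_lt; omega
    · obtain ⟨e', -, h'⟩ := (h e hb.left_lt x (hx hb)).2.2.2.2.2.2.2.2.2.1 hb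
      exact ⟨e', h'⟩

theorem primrecPred_layerStep {α : Type*} [Primcodable α] {n a d t s : α → ℕ} {last : α → Prop}
    (hn : Primrec n) (hlast : PrimrecPred last) (ha : Primrec a) (hd : Primrec d) (ht : Primrec t)
    (hs : Primrec s) :
    PrimrecPred fun v => LayerStep (n v) (last v) (a v) (d v) (t v).Bits (s v).Bits := by
  simp only [layerStep_bits_iff]
  unfold compound
  have h2 : Primrec fun v : (α × ℕ) × ℕ => v.1.1 := Primrec.fst.comp Primrec.fst
  have h3 : Primrec fun v : ((α × ℕ) × ℕ) × ℕ => v.1.1.1 := h2.comp Primrec.fst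
  have he2 : Primrec fun v : (α × ℕ) × ℕ => v.1.2 := Primrec.snd.comp Primrec.fst
  have he3 : Primrec fun v : ((α × ℕ) × ℕ) × ℕ => v.1.1.2 := he2.comp Primrec.fst
  have hx2 : Primrec fun v : (α × ℕ) × ℕ => v.2 := Primrec.snd
  have hx3 : Primrec fun v : ((α × ℕ) × ℕ) × ℕ => v.1.2 := hx2.comp Primrec.fst
  have hy3 : Primrec fun v : ((α × ℕ) × ℕ) × ℕ => v.2 := Primrec.snd
  have hn2 := hn.comp h2
  have hn3 := hn.comp h3
  have ha2 := ha.comp h2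
  have hd2 := hd.comp h2
  have ht1 := ht.comp (Primrec.fst (β := ℕ))
  have ht2 := ht.comp h2
  have ht3 := ht.comp h3
  have hs2 := hs.comp h2
  have hs3 := hs.comp h3
  have hl2 := hlast.comp h2
  have hl3 := hlast.comp h3
  refine (Nat.primrecPred_bits ht hd (Primrec.const 0)).and
    (PrimrecPred.ball ht (PrimrecPred.ball ht1 ?_))
  repeat' with_reducible first
    | assumption
    | exact Primrec.const _
    | apply PrimrecPred.and
    | apply PrimrecPred.or
    | apply PrimrecPred.not
    | apply Nat.primrecPred_bits
    | apply PrimrecPred.ball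
    | apply PrimrecPred.bex
    | apply PrimrecPred.imp
    | apply Primrec.eq.comp
    | apply Primrec.nat_lt.comp
    | apply Primrec.add_fun
    | apply Primrec.mul_fun
    | apply Primrec.pair_fun

end LTLFormula

/-! ### Data words and runs of layers -/

namespace DataWord

variable {A D : Type*} (w : DataWord A D)

theorem sat_untl_iff {i : Fin w.length} {d : D} {φ ψ : LTLFormula A} :
    w.Sat i d (.untl φ ψ) ↔ w.Sat i d φ ∨
      (w.Sat i d ψ ∧ ∃ h : i.val + 1 < w.length, w.Sat ⟨i.val + 1, h⟩ d (.untl φ ψ)) := by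
  simp only [Sat]
  constructor
  · rintro ⟨j, hij, hj, hk⟩
    rcases hij.eq_or_lt with rfl | hlt
    · exact Or.inl hj
    · have : i.val + 1 ≤ j.val := hlt
      exact Or.inr ⟨hk i le_rfl hlt, by omega, j, this, hj, fun k h1 h2 =>
        hk k (Fin.le_def.2 (by have := Fin.le_def.1 h1; simp at this; omega)) h2⟩
  · rintro (h | ⟨h, hl, j, hij, hj, hk⟩)
    · exact ⟨i, le_rfl, h, fun k h1 h2 => absurd h1 (not_le.2 h2)⟩
    · refine ⟨j, Fin.le_def.2 (by have := Fin.le_def.1 hij; simp at this; omega), hj,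
        fun k h1 h2 => ?_⟩
      rcases h1.eq_or_lt with rfl | hlt
      · exact h
      · exact hk k hlt h2

theorem sat_dualUntil_iff {i : Fin w.length} {d : D} {φ ψ : LTLFormula A} :
    w.Sat i d (.dualUntil φ ψ) ↔ w.Sat i d φ ∧
      (w.Sat i d ψ ∨ ∀ h : i.val + 1 < w.length, w.Sat ⟨i.val + 1, h⟩ d (.dualUntil φ ψ)) := by
  simp only [Sat]
  constructor
  · intro h
    refine ⟨(h i le_rfl).resolve_right ?_, or_iff_not_imp_left.2 fun hψ hl j hj => ?_⟩
    · rintro ⟨k, h1, h2, -⟩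
      exact absurd h1 (not_le.2 h2)
    · have hj' : i.val + 1 ≤ j.val := hj
      refine (h j (Fin.le_def.2 (by omega))).imp_right ?_
      rintro ⟨k, h1, h2, h3⟩
      rcases h1.eq_or_lt with rfl | hlt
      · exact absurd h3 hψ
      · exact ⟨k, hlt, h2, h3⟩
  · rintro ⟨h1, h2⟩ j hij
    rcases hij.eq_or_lt with rfl | hlt
    · exact Or.inl h1
    · rcases h2 with h2 | h2
      · exact Or.inr ⟨i, le_rfl, hlt, h2⟩
      · have hlt' : i.val + 1 ≤ j.val := hlt
        refine (h2 (by omega) j hlt').imp_right ?_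
        rintro ⟨k, h3, h4, h5⟩
        exact ⟨k, Fin.le_def.2 (by have := Fin.le_def.1 h3; simp at this; omega), h4, h5⟩

/-- The word with renamed data. -/
def map {D' : Type*} (f : D → D') : DataWord A D' where
  length := w.length
  length_pos := w.length_pos
  letter := w.letter
  datum i := f (w.datum i)

/-- Freezing and both quantifiers put only data of the word into the register, so injectivity on
these data is enough. -/
theorem sat_map_iff {D' : Type*} {f : D → D'} (hf : Set.InjOn f (Set.range w.datum))
    (φ : LTLFormula A) (i j : Fin w.length) :
    (w.map f).Sat i (f (w.datum j)) φ ↔ w.Sat i (w.datum j) φ := by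
  have hf' : ∀ i j, f (w.datum i) = f (w.datum j) ↔ w.datum i = w.datum j := fun i j =>
    hf.eq_iff (Set.mem_range_self i) (Set.mem_range_self j)
  induction φ generalizing i j with
  | test | notTest => simp [Sat, map, hf']
  | letter a | notLetter a => exact Iff.rfl
  | freeze φ ih => exact ih i i
  | next φ ih => exact exists_congr fun h => ih _ j
  | dualNext φ ih => exact forall_congr' fun h => ih _ j
  | existsFuture φ ih => exact exists_congr fun k => and_congr Iff.rfl (ih i k)
  | forallPast φ ih => exact forall_congr' fun k => imp_congr Iff.rfl (ih i k)
  | and φ ψ ih₁ ih₂ => exact and_congr (ih₁ i j) (ih₂ i j)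
  | or φ ψ ih₁ ih₂ => exact or_congr (ih₁ i j) (ih₂ i j)
  | untl φ ψ ih₁ ih₂ =>
    exact exists_congr fun k => and_congr Iff.rfl (and_congr (ih₁ k j)
      (forall_congr' fun l => imp_congr Iff.rfl (imp_congr Iff.rfl (ih₂ l j))))
  | dualUntil φ ψ ih₁ ih₂ =>
    exact forall_congr' fun k => imp_congr Iff.rfl (or_congr (ih₁ k j)
      (exists_congr fun l => and_congr Iff.rfl (and_congr Iff.rfl (ih₂ l j))))

end DataWord

/-! ### Independence of the data domain, and soundness of runs -/

namespace LTLFormula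

theorem Satisfiable.of_injOn {A D D' : Type*} {φ : LTLFormula A}
    (hD : ∀ s : Set D, s.Finite → ∃ f : D → D', Set.InjOn f s) (h : φ.Satisfiable D) :
    φ.Satisfiable D' := by
  obtain ⟨w, hw⟩ := h
  obtain ⟨f, hf⟩ := hD _ (Set.finite_range w.datum)
  exact ⟨w.map f, (w.sat_map_iff hf φ w.first w.first).2 hw⟩

/-- Satisfiability does not depend on the infinite data domain. -/
theorem satisfiable_iff_nat {A D : Type*} [Infinite D] {φ : LTLFormula A} :
    φ.Satisfiable D ↔ φ.Satisfiable ℕ := by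
  refine ⟨Satisfiable.of_injOn fun s hs => ?_, Satisfiable.of_injOn fun s _ =>
    ⟨Infinite.natEmbedding D, (Infinite.natEmbedding D).injective.injOn⟩⟩
  exact Set.countable_iff_exists_injOn.1 hs.countable

variable {n : ℕ}

theorem ofCode_compound (x : ℕ) :
    ofCode n (compound n 0 x) = .freeze (ofCode n x) ∧
    ofCode n (compound n 1 x) = .next (ofCode n x) ∧
    ofCode n (compound n 2 x) = .dualNext (ofCode n x) ∧
    ofCode n (compound n 3 x) = .existsFuture (ofCode n x) ∧
    ofCode n (compound n 4 x) = .forallPast (ofCode n x) := by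
  refine ⟨?_, ?_, ?_, ?_, ?_⟩ <;>
    refine (congrArg (ofCode n) ?_).trans (ofCode_toCode _) <;>
    simp only [toCode, toCode_ofCode, compound, add_zero]

theorem ofCode_compound_pair (x y : ℕ) :
    ofCode n (compound n 5 (Nat.pair x y)) = .untl (ofCode n x) (ofCode n y) ∧
    ofCode n (compound n 6 (Nat.pair x y)) = .dualUntil (ofCode n x) (ofCode n y) ∧
    ofCode n (compound n 7 (Nat.pair x y)) = .and (ofCode n x) (ofCode n y) ∧
    ofCode n (compound n 8 (Nat.pair x y)) = .or (ofCode n x) (ofCode n y) := by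
  refine ⟨?_, ?_, ?_, ?_⟩ <;>
    refine (congrArg (ofCode n) ?_).trans (ofCode_toCode _) <;>
    simp only [toCode, toCode_ofCode, compound]

theorem ofCode_atom :
    ofCode n 0 = .test ∧ ofCode n 1 = .notTest ∧
    (∀ x (h : x < n), ofCode n (x + 2) = .letter ⟨x, h⟩) ∧
    ∀ x (h : x < n), ofCode n (x + n + 2) = .notLetter ⟨x, h⟩ :=
  ⟨ofCode_toCode .test, ofCode_toCode .notTest, fun x h => ofCode_toCode (.letter ⟨x, h⟩),
    fun x h => ofCode_toCode (.notLetter ⟨x, h⟩)⟩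

/-- The sequences `a`, `d`, `t` up to `k` are the letters, the data and the layers of a run. -/
def IsRun (n k : ℕ) (a d t : ℕ → ℕ) : Prop :=
  ∀ i ≤ k, a i < n ∧ LayerStep n (i = k) (a i) (d i) (t i).Bits (t (i + 1)).Bits

/-- The obligations of `b` are met by some run. -/
def HasRun (n b : ℕ) : Prop :=
  ∃ k a d t, IsRun n k a d t ∧ ∀ e q, b.Bits e q → (t 0).Bits e q

/-- The word read off a run. -/
def IsRun.word {k : ℕ} {a d t : ℕ → ℕ} (h : IsRun n k a d t) : DataWord (Fin n) ℕ where
  length := k + 1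
  length_pos := k.succ_pos
  letter i := ⟨a i, (h i (Nat.lt_succ_iff.1 i.2)).1⟩
  datum i := d i

theorem IsRun.step {k : ℕ} {a d t : ℕ → ℕ} (h : IsRun n k a d t) (i : Fin (k + 1)) :
    LayerStep n (i.val = k) (a i) (d i) (t i).Bits (t (i + 1)).Bits :=
  (h i (Nat.lt_succ_iff.1 i.2)).2

theorem IsRun.seen {k : ℕ} {a d t : ℕ → ℕ} (h : IsRun n k a d t) {i j : ℕ} (hij : i ≤ j)
    (hj : j ≤ k) : (t j).Bits (d i) 0 := by
  induction j, hij using Nat.le_induction with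
  | base => exact (h i hj).2.seen_self
  | succ j _ ih =>
    exact ((h j (by omega)).2.seen _ (ih (by omega))).resolve_left (by omega)

/-- The promise of a datum cannot be passed on at the last position, which allows induction on the
distance to the end. -/
theorem IsRun.future {k : ℕ} {a d t : ℕ → ℕ} (h : IsRun n k a d t) {i e : ℕ} (hi : i ≤ k)
    (he : (t i).Bits e 1) : ∃ j, i ≤ j ∧ j ≤ k ∧ e = d j := by
  induction hm : k - i generalizing i with
  | zero => exact ⟨i, le_rfl, hi, ((h i hi).2.future e he).resolve_right fun h' => h'.1 (by omega)⟩
  | succ m ih =>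
    rcases (h i hi).2.future e he with h' | h'
    · exact ⟨i, le_rfl, hi, h'⟩
    · obtain ⟨j, h1, h2, h3⟩ := ih (i := i + 1) (by omega) h'.2 (by omega)
      exact ⟨j, by omega, h2, h3⟩

/-- In negation normal form, obligations need only imply truth. Promised data do occur, which serves
`∃≥↓`; all past data are marked as seen, which serves `∀≤↓`, and superfluous marks only demand more.
-/
theorem IsRun.sat {k : ℕ} {a d t : ℕ → ℕ} (h : IsRun n k a d t) (φ : LTLFormula (Fin n))
    (i : Fin (k + 1)) (e : ℕ) (hφ : (t i).Bits e (toCode φ + 2)) : h.word.Sat i e φ := by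
  induction φ generalizing i e with
  | test => exact (h.step i).test e hφ
  | notTest => exact (h.step i).notTest e hφ
  | letter x => exact Fin.ext ((h.step i).letter e x x.2 hφ).symm
  | notLetter x => exact fun hx => (h.step i).notLetter e x x.2 hφ (Fin.ext_iff.1 hx).symm
  | freeze φ ih => exact ih i _ ((h.step i).freeze e _ hφ)
  | next φ ih =>
    obtain ⟨h1, h2⟩ := (h.step i).next e _ hφ
    have hl : i.val + 1 < k + 1 := by omega
    exact ⟨hl, ih ⟨i + 1, hl⟩ e h2⟩
  | dualNext φ ih =>
    intro hl
    have hl' : i.val + 1 < k + 1 := hl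
    exact ih ⟨i + 1, hl⟩ e (((h.step i).dualNext e _ hφ).resolve_left (by omega))
  | existsFuture φ ih =>
    obtain ⟨e', h1, h2⟩ := (h.step i).existsFuture e _ hφ
    obtain ⟨j, hij, hj, rfl⟩ := h.future (Nat.lt_succ_iff.1 i.2) h2
    exact ⟨⟨j, Nat.lt_succ_iff.2 hj⟩, hij, ih i _ h1⟩
  | forallPast φ ih =>
    exact fun j hj => ih i _ ((h.step i).forallPast e _ hφ _ (h.seen hj (Nat.lt_succ_iff.1 i.2)))
  | and φ ψ ih₁ ih₂ =>
    obtain ⟨h1, h2⟩ := (h.step i).and e _ _ hφ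
    exact ⟨ih₁ i e h1, ih₂ i e h2⟩
  | or φ ψ ih₁ ih₂ => exact ((h.step i).or e _ _ hφ).imp (ih₁ i e) (ih₂ i e)
  | untl φ ψ ih₁ ih₂ =>
    -- An inner induction on the distance to the end: an until that is postponed must be fulfilled
    -- by the last position.
    induction hm : k - i.val generalizing i with
    | zero =>
      exact (h.word.sat_untl_iff).2 <| ((h.step i).untl e _ _ hφ).imp (ih₁ i e)
        fun h' => absurd (by omega) h'.2.1
    | succ m ih =>
      refine (h.word.sat_untl_iff).2 <| ((h.step i).untl e _ _ hφ).imp (ih₁ i e)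
        fun h' => ⟨ih₂ i e h'.1, ?_⟩
      have hl : i.val + 1 < k + 1 := by omega
      exact ⟨hl, ih ⟨i + 1, hl⟩ h'.2.2 (by simp only; omega)⟩
  | dualUntil φ ψ ih₁ ih₂ =>
    induction hm : k - i.val generalizing i with
    | zero =>
      refine (h.word.sat_dualUntil_iff).2 <| ((h.step i).dualUntil e _ _ hφ).imp (ih₁ i e) fun _ =>
        Or.inr fun hl => ?_
      have hl' : i.val + 1 < k + 1 := hl
      omega
    | succ m ih =>
      refine (h.word.sat_dualUntil_iff).2 <| ((h.step i).dualUntil e _ _ hφ).imp (ih₁ i e)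
        fun h' => h'.imp (ih₂ i e) fun h' hl => ?_
      have hl' : i.val + 1 < k + 1 := hl
      exact ih ⟨i + 1, hl⟩ (h'.resolve_left (by omega)) (by simp only; omega)

end LTLFormula

/-! ### Completeness of runs: the true obligations of a word -/

namespace DataWord

open LTLFormula

variable {n : ℕ} (w : DataWord (Fin n) ℕ)

/-- The obligations that are true at a position of a word. -/
def Holds (i : Fin w.length) (e : ℕ) : ℕ → Prop
  | 0 => ∃ j ≤ i, e = w.datum j
  | 1 => ∃ j, i ≤ j ∧ e = w.datum j
  | c + 2 => w.Sat i e (ofCode n c)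

theorem holds_compound (i : Fin w.length) (e x : ℕ) :
    (w.Holds i e (compound n 0 x + 2) ↔ w.Sat i e (.freeze (ofCode n x))) ∧
    (w.Holds i e (compound n 1 x + 2) ↔ w.Sat i e (.next (ofCode n x))) ∧
    (w.Holds i e (compound n 2 x + 2) ↔ w.Sat i e (.dualNext (ofCode n x))) ∧
    (w.Holds i e (compound n 3 x + 2) ↔ w.Sat i e (.existsFuture (ofCode n x))) ∧
    (w.Holds i e (compound n 4 x + 2) ↔ w.Sat i e (.forallPast (ofCode n x))) := by
  obtain ⟨h0, h1, h2, h3, h4⟩ := ofCode_compound (n := n) x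
  simp only [Holds, h0, h1, h2, h3, h4, and_self]

theorem holds_compound_pair (i : Fin w.length) (e x y : ℕ) :
    (w.Holds i e (compound n 5 (Nat.pair x y) + 2) ↔
      w.Sat i e (.untl (ofCode n x) (ofCode n y))) ∧
    (w.Holds i e (compound n 6 (Nat.pair x y) + 2) ↔
      w.Sat i e (.dualUntil (ofCode n x) (ofCode n y))) ∧
    (w.Holds i e (compound n 7 (Nat.pair x y) + 2) ↔
      w.Sat i e (.and (ofCode n x) (ofCode n y))) ∧
    (w.Holds i e (compound n 8 (Nat.pair x y) + 2) ↔
      w.Sat i e (.or (ofCode n x) (ofCode n y))) := by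
  obtain ⟨h5, h6, h7, h8⟩ := ofCode_compound_pair (n := n) x y
  simp only [Holds, h5, h6, h7, h8, and_self]

/-- The true obligations, restricted to bounded data and bounded formulas, form a run. -/
theorem layerStep_holds {N K : ℕ} (hK : 0 < K) (hN : ∀ i, w.datum i < N) {last : Prop}
    (i : Fin w.length) (C : ℕ → ℕ → Prop) (hlast : last ↔ i.val + 1 = w.length)
    (hC : ∀ h : i.val + 1 < w.length, ∀ e q, C e q ↔ e < N ∧ q < K ∧ w.Holds ⟨i + 1, h⟩ e q) :
    LayerStep n last (w.letter i) (w.datum i) (fun e q => e < N ∧ q < K ∧ w.Holds i e q) C := by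
  -- Subformulas have no larger numbers than the formula, so the cut-off at `K` removes no
  -- obligation that a clause demands.
  have hle : ∀ {r x e}, compound n r x + 2 < K → e < N → x + 2 < K := fun {r x e} h _ => by
    have := le_compound n r x
    omega
  have hlp : ∀ {r x y}, compound n r (Nat.pair x y) + 2 < K → x + 2 < K ∧ y + 2 < K :=
    fun {r x y} h => by
      have := le_compound n r (Nat.pair x y)
      have := Nat.left_le_pair x y
      have := Nat.right_le_pair x y
      omega
  have hnext : ¬last → i.val + 1 < w.length := fun h => by
    have := i.2
    rw [hlast] at h
    omega
  have hlt : ∀ h : i.val + 1 < w.length, ¬last := fun h => by rw [hlast]; omega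
  obtain ⟨a0, a1, a2, a3⟩ := ofCode_atom (n := n)
  refine ⟨⟨hN i, hK, i, le_rfl, rfl⟩, ?_, ?_, ?_, ?_, ?_, ?_, ?_, ?_, ?_, ?_, ?_, ?_, ?_, ?_, ?_⟩
  · rintro e ⟨he, hq, j, hj, rfl⟩
    refine or_iff_not_imp_left.2 fun hl => (hC (hnext hl) _ _).2 ⟨he, hq, j, ?_, rfl⟩
    exact hj.trans (Fin.le_def.2 (Nat.le_succ _))
  · rintro e ⟨he, hq, j, hj, rfl⟩
    rcases hj.eq_or_lt with rfl | hj
    · exact Or.inl rfl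
    · have hj' : i.val + 1 ≤ j.val := hj
      have hl : i.val + 1 < w.length := by omega
      exact Or.inr ⟨hlt hl, (hC hl _ _).2 ⟨he, hq, j, hj', rfl⟩⟩
  · rintro e ⟨-, -, h⟩
    simpa [Holds, a0, Sat] using h
  · rintro e ⟨-, -, h⟩
    simpa [Holds, a1, Sat] using h
  · rintro e x hx ⟨-, -, h⟩
    have : w.letter i = ⟨x, hx⟩ := by simpa [Holds, a2 x hx, Sat] using h
    rw [this]
  · rintro e x hx ⟨-, -, h⟩ rfl
    simp [Holds, a3 _ hx, Sat] at h
  · rintro e x ⟨he, hq, h⟩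
    exact ⟨hN i, hle hq he, (w.holds_compound i e x).1.1 h⟩
  · rintro e x ⟨he, hq, h⟩
    obtain ⟨hl, h⟩ := (w.holds_compound i e x).2.1.1 h
    exact ⟨hlt hl, (hC hl _ _).2 ⟨he, hle hq he, h⟩⟩
  · rintro e x ⟨he, hq, h⟩
    exact or_iff_not_imp_left.2 fun hl => (hC (hnext hl) _ _).2
      ⟨he, hle hq he, (w.holds_compound i e x).2.2.1.1 h (hnext hl)⟩
  · rintro e x ⟨he, hq, h⟩
    obtain ⟨j, hj, h⟩ := (w.holds_compound i e x).2.2.2.1.1 h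
    exact ⟨w.datum j, ⟨hN j, hle hq he, h⟩, hN j, by omega, j, hj, rfl⟩
  · rintro e x ⟨he, hq, h⟩ e' ⟨he', -, j, hj, rfl⟩
    exact ⟨he', hle hq he, (w.holds_compound i e x).2.2.2.2.1 h j hj⟩
  · rintro e x y ⟨he, hq, h⟩
    refine (w.sat_untl_iff.1 ((w.holds_compound_pair i e x y).1.1 h)).imp
      (fun h => ⟨he, (hlp hq).1, h⟩) fun ⟨h, hl, h'⟩ => ⟨⟨he, (hlp hq).2, h⟩, hlt hl, ?_⟩
    exact (hC hl _ _).2 ⟨he, hq, (w.holds_compound_pair _ e x y).1.2 h'⟩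
  · rintro e x y ⟨he, hq, h⟩
    refine (w.sat_dualUntil_iff.1 ((w.holds_compound_pair i e x y).2.1.1 h)).imp
      (fun h => ⟨he, (hlp hq).1, h⟩) fun h => h.imp (fun h => ⟨he, (hlp hq).2, h⟩) fun h' =>
        or_iff_not_imp_left.2 fun hl => ?_
    exact (hC (hnext hl) _ _).2 ⟨he, hq, (w.holds_compound_pair _ e x y).2.1.2 (h' (hnext hl))⟩
  · rintro e x y ⟨he, hq, h⟩
    obtain ⟨h1, h2⟩ := (w.holds_compound_pair i e x y).2.2.1.1 h
    exact ⟨⟨he, (hlp hq).1, h1⟩, he, (hlp hq).2, h2⟩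
  · rintro e x y ⟨he, hq, h⟩
    exact ((w.holds_compound_pair i e x y).2.2.2.1 h).imp (fun h => ⟨he, (hlp hq).1, h⟩)
      fun h => ⟨he, (hlp hq).2, h⟩

end DataWord

/-! ### Satisfiability as the existence of a run, and its enumeration -/

namespace LTLFormula

variable {n : ℕ}

/-- The coded obligation that the formula holds, with the first datum in the register. -/
def initial (n c : ℕ) : ℕ := 2 ^ Nat.pair 0 (compound n 0 c + 2)

theorem satisfiable_iff_hasRun (φ : LTLFormula (Fin n)) :
    φ.Satisfiable ℕ ↔ HasRun n (initial n (toCode φ)) := by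
  constructor
  · rintro ⟨w, hw⟩
    obtain ⟨N, hN⟩ : ∃ N, ∀ i, w.datum i < N :=
      ⟨Finset.univ.sup w.datum + 1, fun i => Nat.lt_succ_of_le (Finset.le_sup (Finset.mem_univ i))⟩
    -- The cut-off is the least one that admits the initial obligation `compound n 0 (toCode φ) +
    -- 2`.
    have hex : ∀ i, ∃ t : ℕ, ∀ e q, t.Bits e q ↔
        e < N ∧ q < compound n 0 (toCode φ) + 3 ∧ w.Holds i e q := fun i => by
      obtain ⟨t, -, ht⟩ := Nat.exists_bits_iff (max N (compound n 0 (toCode φ) + 3))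
        (fun e q => e < N ∧ q < compound n 0 (toCode φ) + 3 ∧ w.Holds i e q)
        fun e q h => ⟨lt_max_of_lt_left h.1, lt_max_of_lt_right h.2.1⟩
      exact ⟨t, ht⟩
    choose t ht using hex
    have hpos := w.length_pos
    refine ⟨w.length - 1, fun i => if h : i < w.length then w.letter ⟨i, h⟩ else 0,
      fun i => if h : i < w.length then w.datum ⟨i, h⟩ else 0,
      fun i => if h : i < w.length then t ⟨i, h⟩ else 0, fun i hi => ?_, fun e q hb => ?_⟩
    · have hi' : i < w.length := by omega
      simp only [hi', dite_true]
      refine ⟨Fin.is_lt _, ?_⟩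
      have hT : (t ⟨i, hi'⟩).Bits = fun e q =>
          e < N ∧ q < compound n 0 (toCode φ) + 3 ∧ w.Holds ⟨i, hi'⟩ e q :=
        funext fun e => funext fun q => propext (ht _ e q)
      rw [hT]
      refine w.layerStep_holds (by omega) hN ⟨i, hi'⟩ _ (by simp only; omega) fun h e q => ?_
      simp only at h
      simp only [h, dite_true, ht]
    · obtain ⟨rfl, rfl⟩ := Nat.bits_two_pow.1 hb
      simp only [hpos, dite_true, ht]
      refine ⟨(Nat.zero_le _).trans_lt (hN w.first), by omega, ?_⟩
      rw [(w.holds_compound _ _ _).1, ofCode_toCode]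
      exact hw
  · rintro ⟨k, a, d, t, h, h0⟩
    exact ⟨h.word, h.sat (.freeze φ) 0 0 (h0 0 _ (Nat.bits_two_pow.2 ⟨rfl, rfl⟩))⟩

/-- Having a run is recursively enumerable. -/
theorem rePred_hasRun_initial :
    REPred fun v : ℕ => HasRun v.unpair.1 (initial v.unpair.1 v.unpair.2) := by
  have h : REPred fun v : ℕ => ∃ y : ℕ × List (ℕ × ℕ × ℕ),
      (∀ i < y.1 + 1, (y.2.getD i (0, 0, 0)).1 < v.unpair.1 ∧
        LayerStep v.unpair.1 (i = y.1) (y.2.getD i (0, 0, 0)).1 (y.2.getD i (0, 0, 0)).2.1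
          (y.2.getD i (0, 0, 0)).2.2.Bits (y.2.getD (i + 1) (0, 0, 0)).2.2.Bits) ∧
      (y.2.getD 0 (0, 0, 0)).2.2.testBit (Nat.pair 0 (compound v.unpair.1 0 v.unpair.2 + 2)) := by
    apply PrimrecPred.rePred_exists
    have hn : Primrec fun y : ℕ × ℕ × List (ℕ × ℕ × ℕ) => y.1.unpair.1 :=
      Primrec.fst.comp (Primrec.unpair.comp Primrec.fst)
    have hc : Primrec fun y : ℕ × ℕ × List (ℕ × ℕ × ℕ) => y.1.unpair.2 :=
      Primrec.snd.comp (Primrec.unpair.comp Primrec.fst)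
    have hk : Primrec fun y : ℕ × ℕ × List (ℕ × ℕ × ℕ) => y.2.1 := Primrec.fst.comp Primrec.snd
    have hl : Primrec fun y : ℕ × ℕ × List (ℕ × ℕ × ℕ) => y.2.2 := Primrec.snd.comp Primrec.snd
    have hl1 := hl.comp (Primrec.fst (β := ℕ))
    have hg : Primrec fun y : (ℕ × ℕ × List (ℕ × ℕ × ℕ)) × ℕ => y.1.2.2.getD y.2 (0, 0, 0) :=
      (Primrec.list_getD _).comp hl1 Primrec.snd
    have hg' : Primrec fun y : (ℕ × ℕ × List (ℕ × ℕ × ℕ)) × ℕ =>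
        y.1.2.2.getD (y.2 + 1) (0, 0, 0) :=
      (Primrec.list_getD _).comp hl1 (Primrec.succ.comp Primrec.snd)
    refine (PrimrecPred.ball (Primrec.add_fun hk (Primrec.const 1)) ?_).and ?_
    · refine (Primrec.nat_lt.comp (Primrec.fst.comp hg) (hn.comp Primrec.fst)).and ?_
      exact primrecPred_layerStep (hn.comp Primrec.fst)
        (Primrec.eq.comp Primrec.snd (hk.comp Primrec.fst)) (Primrec.fst.comp hg)
        (Primrec.fst.comp (Primrec.snd.comp hg)) (Primrec.snd.comp (Primrec.snd.comp hg))
        (Primrec.snd.comp (Primrec.snd.comp hg'))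
    · refine PrimrecPred.testBit (Primrec.snd.comp (Primrec.snd.comp
        ((Primrec.list_getD _).comp hl (Primrec.const 0)))) ?_
      unfold compound
      repeat' with_reducible first
        | assumption
        | exact Primrec.const _
        | apply Primrec.pair_fun
        | apply Primrec.add_fun
        | apply Primrec.mul_fun
  refine h.of_eq fun v => ⟨?_, ?_⟩
  · rintro ⟨⟨k, l⟩, h, h0⟩
    refine ⟨k, fun i => (l.getD i (0, 0, 0)).1, fun i => (l.getD i (0, 0, 0)).2.1,
      fun i => (l.getD i (0, 0, 0)).2.2, fun i hi => h i (Nat.lt_succ_of_le hi), fun e q hb => ?_⟩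
    obtain ⟨rfl, rfl⟩ := Nat.bits_two_pow.1 hb
    exact h0
  · rintro ⟨k, a, d, t, h, h0⟩
    -- The list has `k + 2` entries because the condition at the last position `k` still mentions
    -- the layer `k + 1`.
    have hg : ∀ i ≤ k + 1, ((List.range (k + 2)).map fun i => (a i, d i, t i)).getD i (0, 0, 0) =
        (a i, d i, t i) := fun i hi => by
      rw [List.getD_eq_getElem _ _ (by simp; omega)]
      simp
    refine ⟨⟨k, (List.range (k + 2)).map fun i => (a i, d i, t i)⟩, fun i hi => ?_, ?_⟩
    · rw [hg i (Nat.le_of_lt hi), hg (i + 1) hi]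
      exact h i (Nat.lt_succ_iff.1 hi)
    · rw [hg 0 (Nat.zero_le _)]
      exact h0 _ _ (Nat.bits_two_pow.2 ⟨rfl, rfl⟩)

end LTLFormula

/-! ### The embedding ordering of finite sets of obligations -/

namespace LTLFormula

/-- The set of obligations `P` is contained in `Q`, up to an injective renaming of the data. -/
def Embeds (P Q : ℕ → ℕ → Prop) : Prop :=
  ∃ f : ℕ → ℕ, (∀ e₁ q₁ e₂ q₂, P e₁ q₁ → P e₂ q₂ → f e₁ = f e₂ → e₁ = e₂) ∧
    ∀ e q, P e q → Q (f e) q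

theorem Embeds.trans {P Q R : ℕ → ℕ → Prop} : Embeds P Q → Embeds Q R → Embeds P R :=
  fun ⟨f, hf, hPQ⟩ ⟨g, hg, hQR⟩ => ⟨g ∘ f, fun e₁ q₁ e₂ q₂ h₁ h₂ h =>
    hf e₁ q₁ e₂ q₂ h₁ h₂ (hg _ q₁ _ q₂ (hPQ _ _ h₁) (hPQ _ _ h₂) h), fun _ _ h =>
    hQR _ _ (hPQ _ _ h)⟩

theorem Embeds.of_imp {P Q : ℕ → ℕ → Prop} (h : ∀ e q, P e q → Q e q) : Embeds P Q :=
  ⟨id, fun _ _ _ _ _ _ => id, h⟩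

/-- The number `b` codes a set of data below `M` with obligations below `K`. -/
def BoundedBy (b M K : ℕ) : Prop := ∀ e q, b.Bits e q → e < M ∧ q < K

theorem boundedBy_iff {b M K : ℕ} :
    BoundedBy b M K ↔ ∀ e < b, ∀ q < b, b.Bits e q → e < M ∧ q < K :=
  ⟨fun h e _ q _ => h e q, fun h e q hb => h e hb.left_lt q hb.right_lt hb⟩

theorem exists_digits (p : ℕ) (f : ℕ → ℕ) (m : ℕ) (hf : ∀ e < m, f e < p) :
    ∃ F < p ^ m, ∀ e < m, F / p ^ e % p = f e := by
  induction m generalizing f with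
  | zero => exact ⟨0, by simp, fun e he => absurd he (Nat.not_lt_zero e)⟩
  | succ m ih =>
    obtain ⟨F, hF, h⟩ := ih (fun e => f (e + 1)) fun e he => hf _ (Nat.succ_lt_succ he)
    have h0 := hf 0 m.succ_pos
    refine ⟨f 0 + p * F, ?_, fun e he => ?_⟩
    · calc f 0 + p * F < p + p * F := by omega
        _ = p * (F + 1) := by ring
        _ ≤ p * p ^ m := Nat.mul_le_mul_left p hF
        _ = p ^ (m + 1) := by ring
    · cases e with
      | zero => simp [Nat.mod_eq_of_lt h0]
      | succ e =>
        rw [pow_succ', ← Nat.div_div_eq_div_mul, Nat.add_mul_div_left _ _ (by omega),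
          Nat.div_eq_of_lt h0, zero_add, h e (by omega)]

/-- Only the values at the data of `b` matter, and these are below `s`. A renaming is thus coded by
`b` digits in base `s + 1`, which turns its existence into a bounded search. -/
theorem embeds_bits_iff {b s : ℕ} : Embeds b.Bits s.Bits ↔ ∃ F < (s + 1) ^ b,
    (∀ e₁ < b, ∀ q₁ < b, ∀ e₂ < b, ∀ q₂ < b, b.Bits e₁ q₁ → b.Bits e₂ q₂ →
      F / (s + 1) ^ e₁ % (s + 1) = F / (s + 1) ^ e₂ % (s + 1) → e₁ = e₂) ∧
    ∀ e < b, ∀ q < b, b.Bits e q → s.Bits (F / (s + 1) ^ e % (s + 1)) q := by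
  constructor
  · rintro ⟨f, hf, h⟩
    -- Truncation at `s` makes every value a digit and leaves the values at the data of `b`
    -- unchanged.
    obtain ⟨F, hF, hd⟩ := exists_digits (s + 1) (fun e => min (f e) s) b fun e _ =>
      Nat.lt_succ_of_le (min_le_right _ _)
    have hmin : ∀ e q, b.Bits e q → F / (s + 1) ^ e % (s + 1) = f e := fun e q hb => by
      rw [hd e hb.left_lt, min_eq_left (h e q hb).left_lt.le]
    refine ⟨F, hF, fun e₁ _ q₁ _ e₂ _ q₂ _ h₁ h₂ heq => hf e₁ q₁ e₂ q₂ h₁ h₂ ?_,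
      fun e _ q _ hb => ?_⟩
    · rwa [hmin _ _ h₁, hmin _ _ h₂] at heq
    · rw [hmin _ _ hb]
      exact h e q hb
  · rintro ⟨F, -, h1, h2⟩
    exact ⟨fun e => F / (s + 1) ^ e % (s + 1), fun e₁ q₁ e₂ q₂ h₁ h₂ =>
      h1 e₁ h₁.left_lt q₁ h₁.right_lt e₂ h₂.left_lt q₂ h₂.right_lt h₁ h₂,
      fun e q hb => h2 e hb.left_lt q hb.right_lt hb⟩

/-- Sets of obligations below `K` are well-quasi-ordered by `Embeds`, by Higman's lemma. -/
theorem exists_lt_embeds (K : ℕ) (f : ℕ → ℕ) (hf : ∀ i e q, (f i).Bits e q → q < K) :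
    ∃ m n, m < n ∧ Embeds (f m).Bits (f n).Bits := by
  classical
  -- A set is read as a word whose letter at place `e` is the set of obligations of the datum `e`;
  -- the alphabet is finite. The positions of a subword give an increasing, hence injective,
  -- renaming.
  let row : ℕ → ℕ → Finset ℕ := fun b e => (Finset.range K).filter fun q => b.Bits e q
  have hfin : Set.PartiallyWellOrderedOn ((Finset.range K).powerset : Set (Finset ℕ)) Eq :=
    Set.Finite.partiallyWellOrderedOn (Finset.finite_toSet _)
  obtain ⟨m, n, hmn, h⟩ := hfin.partiallyWellOrderedOn_sublistForall₂ Eq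
    fun i => ⟨(List.range (f i)).map (row (f i)), fun x hx => by
      obtain ⟨e, -, rfl⟩ := List.mem_map.1 hx
      exact Finset.mem_coe.2 (Finset.mem_powerset.2 (Finset.filter_subset _ _))⟩
  refine ⟨m, n, hmn, ?_⟩
  obtain ⟨l, hl, hsub⟩ := List.sublistForall₂_iff.1 h
  rw [List.forall₂_eq_eq_eq] at hl
  subst hl
  obtain ⟨g, hg⟩ := List.sublist_iff_exists_orderEmbedding_getElem?_eq.1 hsub
  refine ⟨g, fun _ _ _ _ _ _ h => g.injective h, fun e q hb => ?_⟩
  have he := hg e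
  simp only [List.getElem?_map, List.getElem?_range hb.left_lt] at he
  obtain ⟨e', he', hr⟩ := Option.map_eq_some_iff.1 he.symm
  obtain ⟨hlt, heq⟩ := List.getElem?_eq_some_iff.1 he'
  rw [List.getElem_range] at heq
  subst heq
  have hq : q ∈ row (f m) e := by simpa [row] using ⟨hf _ _ _ hb, hb⟩
  rw [← hr] at hq
  exact (Finset.mem_filter.1 hq).2

/-- Otherwise an infinite sequence could be chosen in which no member embeds in a later one. -/
theorem exists_finite_basis {K : ℕ} {P : ℕ → Prop} (hP : ∀ b, P b → ∀ e q, b.Bits e q → q < K) :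
    ∃ S : Finset ℕ, (∀ b ∈ S, P b) ∧ ∀ s, P s → ∃ b ∈ S, Embeds b.Bits s.Bits := by
  by_contra! h
  obtain ⟨f, hf, hr⟩ := exists_seq_of_forall_finset_exists P
    (fun b s => ¬Embeds b.Bits s.Bits) h
  obtain ⟨m, n, hmn, he⟩ := exists_lt_embeds K f fun i => hP _ (hf i)
  exact hr m n hmn he

/-! ### Restriction of a step to boundedly many data -/

/-- The injection `f` is extended so as to reach the further targets `v j`. The fresh name `M + j`
is used only if `f` misses `v j` on `S` and no smaller index has the same target, which keeps the
extension injective. -/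
theorem exists_renaming {M m : ℕ} {S : ℕ → Prop} {f : ℕ → ℕ} (hS : ∀ e, S e → e < M)
    (hf : ∀ e₁ e₂, S e₁ → S e₂ → f e₁ = f e₂ → e₁ = e₂) (v : ℕ → ℕ) :
    ∃ (R : ℕ → Prop) (g : ℕ → ℕ), (∀ e, R e → e < M + m) ∧
      (∀ e₁ e₂, R e₁ → R e₂ → g e₁ = g e₂ → e₁ = e₂) ∧ (∀ e, S e → R e ∧ g e = f e) ∧
      ∀ j < m, ∃ e, R e ∧ g e = v j := by
  classical
  refine ⟨fun e => S e ∨ ∃ j < m, e = M + j ∧ (∀ e', S e' → f e' ≠ v j) ∧ ∀ i < j, v i ≠ v j,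
    fun e => if S e then f e else v (e - M), ?_, ?_, fun e he => by simp [he], fun j hj => ?_⟩
  · rintro e (he | ⟨j, hj, rfl, -⟩)
    · have := hS e he
      omega
    · omega
  · have hSM : ∀ j, ¬S (M + j) := fun j h => by have := hS _ h; omega
    rintro e₁ e₂ (h₁ | ⟨i, -, rfl, hi, hi'⟩) (h₂ | ⟨j, -, rfl, hj, hj'⟩) h
    · simp only [h₁, h₂, if_true] at h
      exact hf _ _ h₁ h₂ h
    · simp only [h₁, hSM, if_true, if_false, Nat.add_sub_cancel_left] at h
      exact absurd h (hj _ h₁)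
    · simp only [h₂, hSM, if_true, if_false, Nat.add_sub_cancel_left] at h
      exact absurd h.symm (hi _ h₂)
    · simp only [hSM, if_false, Nat.add_sub_cancel_left] at h
      rcases lt_trichotomy i j with hij | rfl | hij
      · exact absurd h (hj' i hij)
      · rfl
      · exact absurd h.symm (hi' j hij)
  · by_cases hex : ∃ e', S e' ∧ f e' = v j
    · obtain ⟨e', he', h⟩ := hex
      exact ⟨e', Or.inl he', by simpa [he'] using h⟩
    · have hi : ∃ i, v i = v j := ⟨j, rfl⟩
      have hM : ¬S (M + Nat.find hi) := fun h => by have := hS _ h; omega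
      refine ⟨M + Nat.find hi, Or.inr ⟨Nat.find hi, (Nat.find_min' hi rfl).trans_lt hj, rfl, ?_, ?_⟩,
        ?_⟩
      · rw [Nat.find_spec hi]
        exact fun e' he' h => hex ⟨e', he', h⟩
      · rw [Nat.find_spec hi]
        exact fun i h => Nat.find_min hi h
      · simp only [hM, if_false, Nat.add_sub_cancel_left]
        exact Nat.find_spec hi

/-- Apart from `existsFuture`, each clause concerns data already present or the current datum. It
therefore suffices to keep the data of `b`, the current datum and `K` witnesses, renamed below `M +
(K + 1)`. -/
theorem LayerStep.restrict {n : ℕ} {last : Prop} {a d : ℕ} {T C : ℕ → ℕ → Prop}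
    (h : LayerStep n last a d T C) {b M K : ℕ} (hK : 0 < K) (hb : BoundedBy b M K)
    (hT : Embeds b.Bits T) :
    ∃ d' < M + (K + 1), ∃ t < 2 ^ ((M + (K + 1)) * (M + (K + 1))),
      ∃ s < 2 ^ ((M + (K + 1)) * (M + (K + 1))), (∀ e q, b.Bits e q → t.Bits e q) ∧
        LayerStep n last a d' t.Bits s.Bits ∧ BoundedBy s (M + (K + 1)) K ∧ Embeds s.Bits C := by
  obtain ⟨f, hf, hfT⟩ := hT
  -- The quantifier overwrites the register, so one witness for `x` serves all data `e` that carry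
  -- the obligation.
  have hw : ∀ x, ∃ e', (∃ e, T e (compound n 3 x + 2)) → T e' (x + 2) ∧ T e' 1 := fun x => by
    by_cases hx : ∃ e, T e (compound n 3 x + 2)
    · obtain ⟨e, he⟩ := hx
      obtain ⟨e', he'⟩ := h.existsFuture e x he
      exact ⟨e', fun _ => he'⟩
    · exact ⟨0, fun h => absurd h hx⟩
  choose wit hwit using hw
  obtain ⟨R, g, hRM, hg, hSR, hv⟩ := exists_renaming (M := M) (m := K + 1)
    (S := fun e => ∃ q, b.Bits e q) (f := f) (fun e ⟨q, hq⟩ => (hb e q hq).1)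
    -- Targets `0, …, K - 1` are the witnesses, target `K` is the current datum.
    (fun e₁ e₂ ⟨q₁, h₁⟩ ⟨q₂, h₂⟩ => hf e₁ q₁ e₂ q₂ h₁ h₂) fun j => if j < K then wit j else d
  have hbits : ∀ P : ℕ → ℕ → Prop, ∃ t < 2 ^ ((M + (K + 1)) * (M + (K + 1))), t.Bits =
      fun e q => R e ∧ q < K ∧ P (g e) q := fun P => by
    obtain ⟨t, ht, h⟩ := Nat.exists_bits_iff (M + (K + 1)) (fun e q => R e ∧ q < K ∧ P (g e) q)
      fun e q h => ⟨hRM e h.1, by omega⟩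
    exact ⟨t, ht, funext fun e => funext fun q => propext (h e q)⟩
  obtain ⟨t, htN, ht⟩ := hbits T
  obtain ⟨s, hsN, hs⟩ := hbits C
  obtain ⟨d', hRd, hd⟩ := hv K (Nat.lt_succ_self K)
  simp only [lt_irrefl, if_false] at hd
  have hwit' : ∀ x < K, ∃ e', R e' ∧ g e' = wit x := fun x hx => by
    simpa [hx] using hv x (by omega)
  refine ⟨d', hRM d' hRd, t, htN, s, hsN, fun e q he => ?_, ?_, fun e q he => ?_, ?_⟩
  · obtain ⟨h1, h2⟩ := hSR e ⟨q, he⟩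
    rw [ht]
    exact ⟨h1, (hb e q he).2, h2 ▸ hfT e q he⟩
  · rw [ht, hs]
    have hle : ∀ {r x}, compound n r x + 2 < K → x + 2 < K := fun {r x} h => by
      have := le_compound n r x
      omega
    have hlp : ∀ {r x y}, compound n r (Nat.pair x y) + 2 < K → x + 2 < K ∧ y + 2 < K :=
      fun {r x y} h => by
        have := le_compound n r (Nat.pair x y)
        have := Nat.left_le_pair x y
        have := Nat.right_le_pair x y
        omega
    constructor
    case seen_self => exact ⟨hRd, hK, hd ▸ h.seen_self⟩
    case seen => exact fun e ⟨he, hq, hT⟩ => (h.seen _ hT).imp_right fun h => ⟨he, hq, h⟩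
    case future =>
      exact fun e ⟨he, hq, hT⟩ => (h.future _ hT).imp
        (fun h => hg _ _ he hRd (h.trans hd.symm)) fun h => ⟨h.1, he, hq, h.2⟩
    case test => exact fun e ⟨he, _, hT⟩ => hg _ _ he hRd ((h.test _ hT).trans hd.symm)
    case notTest => exact fun e ⟨_, _, hT⟩ hed => h.notTest _ hT (by rw [hed, hd])
    case letter => exact fun e x hx ⟨_, _, hT⟩ => h.letter _ x hx hT
    case notLetter => exact fun e x hx ⟨_, _, hT⟩ => h.notLetter _ x hx hT
    case freeze => exact fun e x ⟨_, hq, hT⟩ => ⟨hRd, hle hq, hd ▸ h.freeze _ x hT⟩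
    case next =>
      exact fun e x ⟨he, hq, hT⟩ => ⟨(h.next _ x hT).1, he, hle hq, (h.next _ x hT).2⟩
    case dualNext =>
      exact fun e x ⟨he, hq, hT⟩ => (h.dualNext _ x hT).imp_right fun h => ⟨he, hle hq, h⟩
    case existsFuture =>
      rintro e x ⟨he, hq, hT⟩
      obtain ⟨e', hRe', he'⟩ := hwit' x (by have := hle hq; omega)
      obtain ⟨h1, h2⟩ := hwit x ⟨_, hT⟩
      exact ⟨e', ⟨hRe', hle hq, he' ▸ h1⟩, hRe', by omega, he' ▸ h2⟩
    case forallPast =>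
      exact fun e x ⟨he, hq, hT⟩ e' ⟨he', _, hT'⟩ => ⟨he', hle hq, h.forallPast _ x hT _ hT'⟩
    case untl =>
      exact fun e x y ⟨he, hq, hT⟩ => (h.untl _ x y hT).imp (fun h => ⟨he, (hlp hq).1, h⟩)
        fun h => ⟨⟨he, (hlp hq).2, h.1⟩, h.2.1, he, hq, h.2.2⟩
    case dualUntil =>
      exact fun e x y ⟨he, hq, hT⟩ => (h.dualUntil _ x y hT).imp (fun h => ⟨he, (hlp hq).1, h⟩)
        fun h => h.imp (fun h => ⟨he, (hlp hq).2, h⟩) fun h => h.imp_right fun h => ⟨he, hq, h⟩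
    case and =>
      exact fun e x y ⟨he, hq, hT⟩ => (h.and _ x y hT).imp (fun h => ⟨he, (hlp hq).1, h⟩)
        fun h => ⟨he, (hlp hq).2, h⟩
    case or =>
      exact fun e x y ⟨he, hq, hT⟩ => (h.or _ x y hT).imp (fun h => ⟨he, (hlp hq).1, h⟩)
        fun h => ⟨he, (hlp hq).2, h⟩
  · rw [hs] at he
    exact ⟨hRM e he.1, he.2.1⟩
  · rw [hs]
    exact ⟨g, fun e₁ q₁ e₂ q₂ h₁ h₂ => hg e₁ e₂ h₁.1 h₂.1, fun e q he => he.2.2⟩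

/-! ### Certificates of unsatisfiability -/

/-- The digits of `B` code a finite set of sets of obligations that contains the set with number
`i`, has no element that can be met at a last position, and is closed under steps on data below
`N`, up to `Embeds`. -/
def Refutation (n i B M K N : ℕ) : Prop :=
  0 < K ∧ N = M + (K + 1) ∧ B.testBit i ∧ ∀ b < B, B.testBit b → BoundedBy b M K ∧
    ∀ a < n, ∀ d < N, ∀ t < 2 ^ (N * N), ∀ s < 2 ^ (N * N),
      (∀ e < b, ∀ q < b, b.Bits e q → t.Bits e q) →
        ¬LayerStep n True a d t.Bits s.Bits ∧
        (LayerStep n False a d t.Bits s.Bits → BoundedBy s N K →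
          ∃ b' < B, B.testBit b' ∧ Embeds b'.Bits s.Bits)

/-- If a member embeds in the first layer, the restricted first step cannot be a last one, and it
leads to a set above another member. That member embeds in the second layer, and the run from there
is shorter. -/
theorem Refutation.not_embeds {n i B M K N : ℕ} (h : Refutation n i B M K N) (k : ℕ) :
    ∀ {a d t : ℕ → ℕ}, IsRun n k a d t → ∀ {b}, B.testBit b →
      ¬Embeds b.Bits (t 0).Bits := by
  obtain ⟨hK, rfl, -, hB⟩ := h
  induction k with
  | zero =>
    intro a d t hrun b hb he
    obtain ⟨hbM, hb'⟩ := hB b (Nat.lt_of_testBit_eq_true hb) hb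
    obtain ⟨ha, hstep⟩ := hrun 0 le_rfl
    obtain ⟨d', hd', t', ht', s', hs', hsub, hl, -⟩ := hstep.restrict hK hbM he
    rw [eq_self] at hl
    exact (hb' (a 0) ha d' hd' t' ht' s' hs' fun e _ q _ => hsub e q).1 hl
  | succ k ih =>
    intro a d t hrun b hb he
    obtain ⟨hbM, hb'⟩ := hB b (Nat.lt_of_testBit_eq_true hb) hb
    obtain ⟨ha, hstep⟩ := hrun 0 (Nat.zero_le _)
    obtain ⟨d', hd', t', ht', s', hs', hsub, hl, hsN, hsC⟩ := hstep.restrict hK hbM he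
    rw [eq_false (Nat.succ_ne_zero k).symm] at hl
    obtain ⟨c, -, hc, hcs⟩ :=
      (hb' (a 0) ha d' hd' t' ht' s' hs' fun e _ q _ => hsub e q).2 hl hsN
    refine ih (a := fun i => a (i + 1)) (d := fun i => d (i + 1)) (t := fun i => t (i + 1))
      (fun i hi => ?_) hc (hcs.trans hsC)
    simpa using hrun (i + 1) (Nat.succ_le_succ hi)

theorem Refutation.not_hasRun {n i B M K N : ℕ} (h : Refutation n i B M K N) : ¬HasRun n i :=
  fun ⟨k, _, _, _, hrun, h0⟩ => h.not_embeds k hrun h.2.2.1 (Embeds.of_imp h0)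

theorem HasRun.of_last {n b a d t s : ℕ} (ha : a < n) (hb : ∀ e q, b.Bits e q → t.Bits e q)
    (h : LayerStep n True a d t.Bits s.Bits) : HasRun n b := by
  refine ⟨0, fun _ => a, fun _ => d, fun i => if i = 0 then t else s, fun i hi => ?_, hb⟩
  obtain rfl := Nat.le_zero.1 hi
  exact ⟨ha, by simpa using h⟩

/-- The next layer occurs only positively in the clauses. -/
theorem LayerStep.mono {n : ℕ} {last : Prop} {a d : ℕ} {T C C' : ℕ → ℕ → Prop}
    (h : LayerStep n last a d T C) (hC : ∀ e q, C e q → C' e q) : LayerStep n last a d T C' where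
  __ := h
  seen e hT := (h.seen e hT).imp_right (hC _ _)
  future e hT := (h.future e hT).imp_right (And.imp_right (hC _ _))
  next e x hT := (h.next e x hT).imp_right (hC _ _)
  dualNext e x hT := (h.dualNext e x hT).imp_right (hC _ _)
  untl e x y hT := (h.untl e x y hT).imp_right (And.imp_right (And.imp_right (hC _ _)))
  dualUntil e x y hT := (h.dualUntil e x y hT).imp_right (Or.imp_right (Or.imp_right (hC _ _)))

theorem HasRun.of_step {n b a d t s : ℕ} (ha : a < n) (hb : ∀ e q, b.Bits e q → t.Bits e q)
    (h : LayerStep n False a d t.Bits s.Bits) (hs : HasRun n s) : HasRun n b := by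
  obtain ⟨k, a', d', t', hrun, h0⟩ := hs
  refine ⟨k + 1, fun i => Nat.casesOn i a a', fun i => Nat.casesOn i d d',
    fun i => Nat.casesOn i t t', fun i hi => ?_, hb⟩
  cases i with
  | zero =>
    refine ⟨ha, ?_⟩
    rw [eq_false (Nat.succ_ne_zero k).symm]
    exact h.mono h0
  | succ i => simpa using hrun i (Nat.le_of_succ_le_succ hi)

/-- The certificate is a finite basis of the sets without a run. A step from such a set leads again
to a set without a run, hence above a basis element. -/
theorem exists_refutation {n i : ℕ} (h : ¬HasRun n i) : ∃ B M K N, Refutation n i B M K N := by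
  -- All obligations in `i` are below `i + 1`, and steps are only considered within this bound. The
  -- set `i` is added to the basis because the certificate must contain `i` itself.
  obtain ⟨S, hS, hbasis⟩ := exists_finite_basis (K := i + 1)
    (P := fun b => (∀ e q, b.Bits e q → q < i + 1) ∧ ¬HasRun n b) fun b hb => hb.1
  have hSi : ∀ b ∈ insert i S, (∀ e q, b.Bits e q → q < i + 1) ∧ ¬HasRun n b := by
    intro b hb
    rcases Finset.mem_insert.1 hb with rfl | hb
    · exact ⟨fun e q hq => hq.right_lt.trans (Nat.lt_succ_self _), h⟩
    · exact hS b hb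
  -- A bound on the codes of the members also bounds the data in them.
  have hM : ∀ b ∈ insert i S, b < (insert i S).sup id + 1 := fun b hb =>
    Nat.lt_succ_of_le (Finset.le_sup (f := id) hb)
  obtain ⟨B, -, hB⟩ := Nat.exists_testBit_iff _ (· ∈ insert i S) hM
  refine ⟨B, (insert i S).sup id + 1, i + 1, _, i.succ_pos, rfl,
    (hB i).2 (Finset.mem_insert_self i S), fun b _ hb => ?_⟩
  rw [hB] at hb
  obtain ⟨hbK, hbrun⟩ := hSi b hb
  refine ⟨fun e q he => ⟨he.left_lt.trans (hM b hb), hbK e q he⟩,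
    fun a ha d _ t _ s _ hsub => ?_⟩
  have hsub' : ∀ e q, b.Bits e q → t.Bits e q := fun e q he => hsub e he.left_lt q he.right_lt he
  refine ⟨fun hl => hbrun (HasRun.of_last ha hsub' hl), fun hl hs => ?_⟩
  obtain ⟨b', hb', he⟩ := hbasis s
    ⟨fun e q he => (hs e q he).2, fun hr => hbrun (HasRun.of_step ha hsub' hl hr)⟩
  have hb' := (hB b').2 (Finset.mem_insert_of_mem hb')
  exact ⟨b', Nat.lt_of_testBit_eq_true hb', hb', he⟩

/-! ### Enumeration of the unsatisfiable instances -/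

theorem primrecPred_embeds {α : Type*} [Primcodable α] {b s : α → ℕ} (hb : Primrec b)
    (hs : Primrec s) : PrimrecPred fun v => Embeds (b v).Bits (s v).Bits := by
  have hid : Primrec fun v : α => v := Primrec.id
  simp only [embeds_bits_iff]
  repeat' with_reducible first
    | exact Primrec.const _
    | exact Primrec.fst
    | exact Primrec.snd
    | apply PrimrecPred.and
    | apply Nat.primrecPred_bits
    | apply PrimrecPred.ball
    | apply PrimrecPred.bex
    | apply PrimrecPred.imp
    | apply Primrec.eq.comp
    | apply Primrec.pow_fun
    | apply Primrec.mod_fun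
    | apply Primrec.div_fun
    | apply Primrec.add_fun
    | apply Primrec.pair_fun
    | apply hb.comp
    | apply hs.comp
    | exact hid
    | apply Primrec.fst_fun
    | apply Primrec.snd_fun

theorem primrecPred_boundedBy {α : Type*} [Primcodable α] {b M K : α → ℕ} (hb : Primrec b)
    (hM : Primrec M) (hK : Primrec K) : PrimrecPred fun v => BoundedBy (b v) (M v) (K v) := by
  have hid : Primrec fun v : α => v := Primrec.id
  simp only [boundedBy_iff]
  repeat' with_reducible first
    | exact Primrec.fst
    | exact Primrec.snd
    | apply PrimrecPred.and
    | apply Nat.primrecPred_bits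
    | apply PrimrecPred.ball
    | apply PrimrecPred.imp
    | apply Primrec.nat_lt.comp
    | apply Primrec.pair_fun
    | apply hb.comp
    | apply hM.comp
    | apply hK.comp
    | exact hid
    | apply Primrec.fst_fun
    | apply Primrec.snd_fun

/-- Having no run is recursively enumerable. -/
theorem rePred_not_hasRun_initial :
    REPred fun v : ℕ => ¬HasRun v.unpair.1 (initial v.unpair.1 v.unpair.2) := by
  have h : REPred fun v : ℕ => ∃ y : ℕ × ℕ × ℕ × ℕ,
      Refutation v.unpair.1 (initial v.unpair.1 v.unpair.2) y.1 y.2.1 y.2.2.1 y.2.2.2 := by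
    apply PrimrecPred.rePred_exists
    unfold Refutation initial compound
    repeat' with_reducible first
      | exact Primrec.const _
      | exact Primrec.fst
      | exact Primrec.snd
      | exact PrimrecPred.const _
      | apply primrecPred_boundedBy
      | apply primrecPred_embeds
      | apply primrecPred_layerStep
      | apply PrimrecPred.and
      | apply PrimrecPred.not
      | apply PrimrecPred.testBit
      | apply Nat.primrecPred_bits
      | apply PrimrecPred.ball
      | apply PrimrecPred.bex
      | apply PrimrecPred.imp
      | apply Primrec.eq.comp
      | apply Primrec.nat_lt.comp
      | apply Primrec.pow_fun
      | apply Primrec.add_fun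
      | apply Primrec.mul_fun
      | apply Primrec.pair_fun
      | apply Primrec.fst_fun
      | apply Primrec.snd_fun
      | apply Primrec.unpair_fun
  refine h.of_eq fun v => ⟨fun ⟨_, hr⟩ => hr.not_hasRun, fun hv => ?_⟩
  obtain ⟨B, M, K, N, hr⟩ := exists_refutation hv
  exact ⟨(B, M, K, N), hr⟩

end LTLFormula

theorem mainTheorem4 (D : Type*) [Infinite D] :
    ComputablePred (fun x : (Σ n : ℕ, LTLFormula (Fin n)) => x.2.Satisfiable D) := by
  have h : ComputablePred fun v : ℕ =>
      LTLFormula.HasRun v.unpair.1 (LTLFormula.initial v.unpair.1 v.unpair.2) :=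
    ComputablePred.computable_iff_re_compl_re'.2
      ⟨LTLFormula.rePred_hasRun_initial, LTLFormula.rePred_not_hasRun_initial⟩
  obtain ⟨hdec, h⟩ := h
  refine ComputablePred.of_eq
    ⟨fun x => hdec (Encodable.encode x), h.comp Computable.encode⟩ fun x => ?_
  rw [LTLFormula.satisfiable_iff_nat, LTLFormula.satisfiable_iff_hasRun, LTLFormula.encode_sigma]
  simp only [Nat.unpair_pair]
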